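/- Let $L>0$, $T\ge 0$, let $a\in C^1([0,L])$ with $a>0$ and $\sigma\in C^2([0,L]\times[0,T])$ be deterministic real functions, and let $w$ be a standard Wiener process. For $t\in[0,T]$ and $\theta\in[0,L]$ put $\tilde\eta(\theta;t)=\big(\tfrac12\int_0^t\sigma^2(\theta,\tau)\,d\tau\big)^{1/2}$. For integers $0\le n\le N$, $N\ge1$, put $\Delta=L/N$, $l_j=j\Delta$, and consider the chain field $$\hat x_{n}(t)=\sum_{s=1}^{n}a(l_s)\cos\Big[\sum_{j=1}^{s}\big(w(l_{j+1})-w(l_j)\big)\,\tilde\eta(l_j;t)\Big]\Delta,\qquad \hat y_{n}(t)=\sum_{s=1}^{n}a(l_s)\sin\Big[\sum_{j=1}^{s}\big(w(l_{j+1})-w(l_j)\big)\,\tilde\eta(l_j;t)\Big]\Delta .$$ Consider also the continuum field $$x(l;t)=\int_0^l a(u)\cos\Big[\int_0^u\tilde\eta(\theta;t)\,dw(\theta)\Big]du,\qquad y(l;t)=\int_0^l a(u)\sin\Big[\int_0^u\tilde\eta(\theta;t)\,dw(\theta)\Big]du,$$ where the inner integrals are Wiener integrals, taken in any version that is jointly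 measurable in $(u,\omega)$; such a version exists. Then in the limit the characteristic functions of the two fields coincide: for every $t\in[0,T]$, every $l\in[0,L]$, all $N\to\infty$ and $n\le N$ with $n\Delta=nL/N\to l$, and all real $\alpha,\beta$, $$\mathbf E\exp\{i(\alpha\hat x_n(t)+\beta\hat y_n(t))\}\longrightarrow \mathbf E\exp\{i(\alpha x(l;t)+\beta y(l;t))\}.$$ -/

import Mathlib

open MeasureTheory ProbabilityTheory Filter Topology
open scoped NNReal ENNReal

noncomputable section

/-- The step function equal to `c i` on `(τ i, τ (i + 1)]` for `i < m`. -/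
def stepFun (m : ℕ) (τ : ℕ → ℝ≥0) (c : ℕ → ℝ) (θ : ℝ) : ℝ :=
  ∑ i ∈ Finset.range m, (Set.Ioc (τ i : ℝ) (τ (i + 1))).indicator (fun _ => c i) θ

/-- The elementary stochastic integral of `stepFun m τ c` with respect to the process `w`. -/
def stepIntegral {Ω : Type*} (w : ℝ≥0 → Ω → ℝ) (m : ℕ) (τ : ℕ → ℝ≥0) (c : ℕ → ℝ) (ω : Ω) : ℝ :=
  ∑ i ∈ Finset.range m, c i * (w (τ (i + 1)) ω - w (τ i) ω)

/-- `X` is (a version of) the Wiener integral `∫_0^u f dw` of the deterministic function `f`: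
the mean-square limit of the elementary integrals of step functions that are subordinate to
finite partitions of `[0, u]` and converge to `f` in `L²(0, u)`. -/
structure IsWienerIntegral {Ω : Type*} [MeasurableSpace Ω] (μ : Measure Ω) (w : ℝ≥0 → Ω → ℝ)
    (f : ℝ → ℝ) (u : ℝ) (X : Ω → ℝ) : Prop where
  memLp : MemLp X 2 μ
  exists_approx : ∃ (m : ℕ → ℕ) (τ : ℕ → ℕ → ℝ≥0) (c : ℕ → ℕ → ℝ),
    (∀ k, Monotone (τ k) ∧ τ k 0 = 0 ∧ (τ k (m k) : ℝ) = u) ∧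
    Tendsto (fun k => eLpNorm (fun θ => f θ - stepFun (m k) (τ k) (c k) θ) 2
      (volume.restrict (Set.Ioc 0 u))) atTop (𝓝 0) ∧
    Tendsto (fun k => eLpNorm (fun ω => X ω - stepIntegral w (m k) (τ k) (c k) ω) 2 μ)
      atTop (𝓝 0)

/-- `Y` is a jointly measurable version on `[0, L]` of the process `u ↦ ∫_0^u f dw`
(for instance its continuous version). -/
structure IsWienerIntegralProcess {Ω : Type*} [MeasurableSpace Ω] (μ : Measure Ω)
    (w : ℝ≥0 → Ω → ℝ) (f : ℝ → ℝ) (L : ℝ) (Y : ℝ → Ω → ℝ) : Prop where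
  aestronglyMeasurable :
    AEStronglyMeasurable (Function.uncurry Y) ((volume.restrict (Set.Icc 0 L)).prod μ)
  isWienerIntegral : ∀ u ∈ Set.Icc 0 L, IsWienerIntegral μ w f u (Y u)

/-- The deterministic intensity `(½ ∫_0^t σ(θ, τ)² dτ)^{1/2}`. -/
def angleIntensity (σ : ℝ → ℝ → ℝ) (t θ : ℝ) : ℝ :=
  Real.sqrt (1 / 2 * ∫ τ in (0 : ℝ)..t, σ θ τ ^ 2)

/-- The node `l_j = j Δ`, with `Δ = L / N`. -/
def node (L : ℝ) (N j : ℕ) : ℝ := j * (L / N)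

/-- The angle of the `s`-th link: the sum over `1 ≤ j ≤ s` of the increment of `w` over
`[l_j, l_{j+1}]` times the intensity at `l_j`. -/
def chainAngle {Ω : Type*} (w : ℝ≥0 → Ω → ℝ) (σ : ℝ → ℝ → ℝ) (t L : ℝ) (N s : ℕ) (ω : Ω) : ℝ :=
  ∑ j ∈ Finset.Icc 1 s,
    (w (node L N (j + 1)).toNNReal ω - w (node L N j).toNNReal ω) *
      angleIntensity σ t (node L N j)

/-- First coordinate of the end point of the chain of the first `n` links. -/
def chainX {Ω : Type*} (w : ℝ≥0 → Ω → ℝ) (a : ℝ → ℝ) (σ : ℝ → ℝ → ℝ) (t L : ℝ) (N n : ℕ)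
    (ω : Ω) : ℝ :=
  ∑ s ∈ Finset.Icc 1 n, a (node L N s) * Real.cos (chainAngle w σ t L N s ω) * (L / N)

/-- Second coordinate of the end point of the chain of the first `n` links. -/
def chainY {Ω : Type*} (w : ℝ≥0 → Ω → ℝ) (a : ℝ → ℝ) (σ : ℝ → ℝ → ℝ) (t L : ℝ) (N n : ℕ)
    (ω : Ω) : ℝ :=
  ∑ s ∈ Finset.Icc 1 n, a (node L N s) * Real.sin (chainAngle w σ t L N s ω) * (L / N)

/-- First coordinate of the continuum field with angle process `Y`. -/
def contX {Ω : Type*} (a : ℝ → ℝ) (Y : ℝ → Ω → ℝ) (l : ℝ) (ω : Ω) : ℝ :=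
  ∫ u in (0 : ℝ)..l, a u * Real.cos (Y u ω)

/-- Second coordinate of the continuum field with angle process `Y`. -/
def contY {Ω : Type*} (a : ℝ → ℝ) (Y : ℝ → Ω → ℝ) (l : ℝ) (ω : Ω) : ℝ :=
  ∫ u in (0 : ℝ)..l, a u * Real.sin (Y u ω)

/-- The characteristic function `(α, β) ↦ 𝔼 exp (i (α X + β Y))` of a pair of random variables. -/
def pairCharFun {Ω : Type*} [MeasurableSpace Ω] (μ : Measure Ω) (X Y : Ω → ℝ) (α β : ℝ) : ℂ :=
  ∫ ω, Complex.exp (Complex.I * ((α * X ω + β * Y ω : ℝ) : ℂ)) ∂μ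

end

/-! Chain and continuum are driven by the same `w`, and more than the claim holds: each coordinate
of the chain converges in mean to that of the continuum. Since `x ↦ exp (i x)` is 1-Lipschitz, the
characteristic functions follow (`tendsto_pairCharFun`).

The angle of a link is the elementary integral of a step function, `gridFun`. By the Itô isometry
its mean-square distance to the Wiener integral at `u` is at most the `L²` distance on the line
between `gridFun` and the intensity cut off at `u` (`IsWienerIntegral.eLpNorm_incrementSum_sub_le`).
That distance is small uniformly in `u`: inside, the modulus of continuity of the intensity controls
it, and there are two edge errors on sets of length `O(Δ)` (`abs_gridFun_sub_le`). Tonelli and the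
Lipschitz bounds for cos and sin carry the estimate to the Riemann sums; the piece between `l_n` and
`l` costs at most `A |l_n - l|` (`lintegral_chainSum_sub_le`).

For existence, the same estimate makes the grid sums Cauchy in mean square, at a geometric rate
uniform in `u` along a suitable sequence of grids. Their pointwise limit is jointly measurable and
is a Wiener integral for every `u` (`exists_isWienerIntegralProcess`). -/

/-- The weighted sum of the increments of `w` over the intervals `(p i, q i]`. -/
def incrementSum {ι Ω : Type*} (w : ℝ≥0 → Ω → ℝ) (S : Finset ι) (p q : ι → ℝ≥0) (c : ι → ℝ)
    (ω : Ω) : ℝ :=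
  ∑ i ∈ S, c i * (w (q i) ω - w (p i) ω)

/-- The weighted sum of the indicators of the intervals `(p i, q i]`. -/
noncomputable def intervalSum {ι : Type*} (S : Finset ι) (p q : ι → ℝ≥0) (c : ι → ℝ) (θ : ℝ) : ℝ :=
  ∑ i ∈ S, (Set.Ioc (p i : ℝ) (q i)).indicator (fun _ => c i) θ

lemma stepIntegral_eq_incrementSum {Ω : Type*} (w : ℝ≥0 → Ω → ℝ) (m : ℕ) (τ : ℕ → ℝ≥0) (c : ℕ → ℝ) :
    stepIntegral w m τ c = incrementSum w (Finset.range m) τ (fun i => τ (i + 1)) c := rfl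

lemma stepFun_eq_intervalSum (m : ℕ) (τ : ℕ → ℝ≥0) (c : ℕ → ℝ) :
    stepFun m τ c = intervalSum (Finset.range m) τ (fun i => τ (i + 1)) c := rfl

lemma stepFun_eq_zero_of_notMem {m : ℕ} {τ : ℕ → ℝ≥0} (hτ : Monotone τ)
    (c : ℕ → ℝ) {θ : ℝ} (hθ : θ ∉ Set.Ioc (0 : ℝ) (τ m)) : stepFun m τ c θ = 0 := by
  refine Finset.sum_eq_zero fun i hi => Set.indicator_of_notMem (fun h => hθ ⟨?_, ?_⟩) _
  · exact lt_of_le_of_lt (τ i).coe_nonneg h.1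
  · exact h.2.trans (NNReal.coe_le_coe.2 (hτ (Finset.mem_range.1 hi)))

/-! ### Itô isometry for elementary and Wiener integrals -/

section isometry

variable {Ω : Type*} [MeasurableSpace Ω] {μ : Measure Ω} {w : ℝ≥0 → Ω → ℝ}

lemma memLp_increment (hw : IsPreBrownianReal w μ) (s t : ℝ≥0) :
    MemLp (fun ω => w t ω - w s ω) 2 μ :=
  (hw.isGaussianProcess.hasGaussianLaw_eval t).memLp_two.sub
    (hw.isGaussianProcess.hasGaussianLaw_eval s).memLp_two

lemma memLp_incrementSum (hw : IsPreBrownianReal w μ) {ι : Type*} (S : Finset ι)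
    (p q : ι → ℝ≥0) (c : ι → ℝ) : MemLp (incrementSum w S p q c) 2 μ :=
  memLp_finsetSum _ fun i _ => (memLp_increment hw (p i) (q i)).const_mul (c i)

lemma memLp_indicator_Ioc (a b c : ℝ) :
    MemLp ((Set.Ioc a b).indicator fun _ => c) 2 (volume : Measure ℝ) :=
  memLp_indicator_const 2 measurableSet_Ioc c (Or.inr measure_Ioc_lt_top.ne)

lemma memLp_intervalSum {ι : Type*} (S : Finset ι) (p q : ι → ℝ≥0) (c : ι → ℝ) :
    MemLp (intervalSum S p q c) 2 (volume : Measure ℝ) :=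
  memLp_finsetSum _ fun _ _ => memLp_indicator_Ioc _ _ _

lemma integral_indicator_Ioc_mul (a b a' b' c c' : ℝ) :
    ∫ θ, (Set.Ioc a b).indicator (fun _ => c) θ * (Set.Ioc a' b').indicator (fun _ => c') θ =
      c * c' * max 0 (min b b' - max a a') := by
  have h : ∀ θ, (Set.Ioc a b).indicator (fun _ => c) θ *
      (Set.Ioc a' b').indicator (fun _ => c') θ =
      (Set.Ioc (max a a') (min b b')).indicator (fun _ => c * c') θ := by
    intro θ
    rw [← Set.Ioc_inter_Ioc,
      Set.inter_indicator_mul]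
  simp_rw [h]
  rw [integral_indicator_const _ measurableSet_Ioc, smul_eq_mul, measureReal_def, Real.volume_Ioc,
    ENNReal.toReal_ofReal', max_comm, mul_comm]

/-- Increments are centred, so this second moment is a covariance; `Cov(w s, w t) = min s t` turns
it into the length of the overlap of the two intervals. -/
lemma integral_increment_mul (hw : IsPreBrownianReal w μ) {p q p' q' : ℝ≥0} (h : p ≤ q)
    (h' : p' ≤ q') :
    ∫ ω, (w q ω - w p ω) * (w q' ω - w p' ω) ∂μ =
      max 0 (min (q : ℝ) q' - max (p : ℝ) p') := by
  have := hw.isGaussianProcess.isProbabilityMeasure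
  have hL := fun t => (hw.isGaussianProcess.hasGaussianLaw_eval t).memLp_two
  have h0 : ∀ s t, ∫ ω, (w t ω - w s ω) ∂μ = 0 := fun s t => by
    rw [integral_sub (hw.integrable_eval _) (hw.integrable_eval _), hw.integral_eval,
      hw.integral_eval, sub_zero]
  have hc := covariance_eq_sub (memLp_increment hw p q) (memLp_increment hw p' q')
  rw [h0, zero_mul, sub_zero, covariance_fun_sub_fun_sub (hL _) (hL _) (hL _) (hL _)] at hc
  simp only [hw.covariance_eval, NNReal.coe_min] at hc
  refine Eq.trans hc.symm ?_
  have h1 : (p : ℝ) ≤ q := h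
  have h1' : (p' : ℝ) ≤ q' := h'
  generalize (p : ℝ) = p at *
  generalize (q : ℝ) = q at *
  generalize (p' : ℝ) = p' at *
  generalize (q' : ℝ) = q' at *
  simp only [min_def, max_def]
  split_ifs <;> linarith

/-- The Itô isometry for elementary integrals, in terms of second moments. -/
lemma integral_incrementSum_sq (hw : IsPreBrownianReal w μ) {ι : Type*} (S : Finset ι)
    {p q : ι → ℝ≥0} (hpq : ∀ i ∈ S, p i ≤ q i) (c : ι → ℝ) :
    ∫ ω, incrementSum w S p q c ω ^ 2 ∂μ = ∫ θ, intervalSum S p q c θ ^ 2 := by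
  simp only [incrementSum, intervalSum, sq, Finset.sum_mul_sum]
  have hA : ∀ i j, Integrable (fun ω => c i * (w (q i) ω - w (p i) ω) *
      (c j * (w (q j) ω - w (p j) ω))) μ := fun i j =>
    ((memLp_increment hw (p i) (q i)).const_mul (c i)).integrable_mul
      ((memLp_increment hw (p j) (q j)).const_mul (c j))
  have hB : ∀ i j, Integrable (fun θ => (Set.Ioc (p i : ℝ) (q i)).indicator (fun _ => c i) θ *
      (Set.Ioc (p j : ℝ) (q j)).indicator (fun _ => c j) θ) volume := fun i j =>
    (memLp_indicator_Ioc _ _ _).integrable_mul (memLp_indicator_Ioc _ _ _)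
  rw [integral_finsetSum _ fun i _ => integrable_finsetSum _ fun j _ => hA i j,
    integral_finsetSum _ fun i _ => integrable_finsetSum _ fun j _ => hB i j]
  refine Finset.sum_congr rfl fun i hi => ?_
  rw [integral_finsetSum _ fun j _ => hA i j, integral_finsetSum _ fun j _ => hB i j]
  refine Finset.sum_congr rfl fun j hj => ?_
  rw [integral_indicator_Ioc_mul, ← integral_increment_mul hw (hpq i hi) (hpq j hj),
    ← integral_const_mul]
  congr with ω
  ring

/-- The Itô isometry for elementary integrals. -/
lemma eLpNorm_incrementSum (hw : IsPreBrownianReal w μ) {ι : Type*} (S : Finset ι)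
    {p q : ι → ℝ≥0} (hpq : ∀ i ∈ S, p i ≤ q i) (c : ι → ℝ) :
    eLpNorm (incrementSum w S p q c) 2 μ = eLpNorm (intervalSum S p q c) 2 volume := by
  rw [(memLp_incrementSum hw S p q c).eLpNorm_eq_integral_rpow_norm (by simp) (by simp),
    (memLp_intervalSum S p q c).eLpNorm_eq_integral_rpow_norm (by simp) (by simp)]
  simp only [ENNReal.toReal_ofNat, Real.rpow_two, Real.norm_eq_abs, sq_abs]
  rw [integral_incrementSum_sq hw S hpq c]

/-- A difference of two elementary integrals is again one, indexed by the disjoint union with the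
second weights negated. The isometry allows overlapping intervals, so no common refinement is
needed. -/
lemma eLpNorm_incrementSum_sub (hw : IsPreBrownianReal w μ) {ι κ : Type*} (S : Finset ι)
    {p q : ι → ℝ≥0} (hpq : ∀ i ∈ S, p i ≤ q i) (c : ι → ℝ) (S' : Finset κ)
    {p' q' : κ → ℝ≥0} (hpq' : ∀ i ∈ S', p' i ≤ q' i) (c' : κ → ℝ) :
    eLpNorm (incrementSum w S p q c - incrementSum w S' p' q' c') 2 μ =
      eLpNorm (intervalSum S p q c - intervalSum S' p' q' c') 2 volume := by
  have h := eLpNorm_incrementSum hw (S.disjSum S') (p := Sum.elim p p') (q := Sum.elim q q')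
    (by rintro (i | i) hi
        · exact hpq i (by simpa using hi)
        · exact hpq' i (by simpa using hi)) (Sum.elim c (-c'))
  have e1 : incrementSum w (S.disjSum S') (Sum.elim p p') (Sum.elim q q') (Sum.elim c (-c')) =
      incrementSum w S p q c - incrementSum w S' p' q' c' := by
    ext ω
    simp [incrementSum, Finset.sum_disjSum, sub_eq_add_neg]
  have e2 : intervalSum (S.disjSum S') (Sum.elim p p') (Sum.elim q q') (Sum.elim c (-c')) =
      intervalSum S p q c - intervalSum S' p' q' c' := by
    ext θ
    simp only [intervalSum, Finset.sum_disjSum, Sum.elim_inl, Sum.elim_inr, Pi.sub_apply,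
      sub_eq_add_neg, ← Finset.sum_neg_distrib, Pi.neg_apply, Set.indicator_neg]
  rwa [e1, e2] at h

/-- The Itô isometry between elementary integrals and Wiener integrals, as a bound. -/
lemma IsWienerIntegral.eLpNorm_incrementSum_sub_le (hw : IsPreBrownianReal w μ) {f : ℝ → ℝ}
    {u : ℝ} {X : Ω → ℝ} (hX : IsWienerIntegral μ w f u X) (hf : AEStronglyMeasurable f volume)
    {ι : Type*} (S : Finset ι) {p q : ι → ℝ≥0} (hpq : ∀ i ∈ S, p i ≤ q i) (c : ι → ℝ) :
    eLpNorm (incrementSum w S p q c - X) 2 μ ≤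
      eLpNorm (intervalSum S p q c - (Set.Ioc 0 u).indicator f) 2 volume := by
  obtain ⟨m, τ, d, hτ, h1, h2⟩ := hX.exists_approx
  -- The triangle inequality through the k-th approximant bounds the left side by this sum for every
  -- `k`; its last two terms vanish in the limit.
  have hlim : Tendsto (fun k => eLpNorm (intervalSum S p q c - (Set.Ioc 0 u).indicator f) 2 volume +
      eLpNorm (fun θ => f θ - stepFun (m k) (τ k) (d k) θ) 2 (volume.restrict (Set.Ioc 0 u)) +
      eLpNorm (fun ω => X ω - stepIntegral w (m k) (τ k) (d k) ω) 2 μ) atTop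
      (𝓝 (eLpNorm (intervalSum S p q c - (Set.Ioc 0 u).indicator f) 2 volume + 0 + 0)) :=
    (tendsto_const_nhds.add h1).add h2
  simp only [add_zero] at hlim
  refine ge_of_tendsto' hlim fun k => ?_
  obtain ⟨hm, -, hu⟩ := hτ k
  set I := stepIntegral w (m k) (τ k) (d k) with hI
  set F := stepFun (m k) (τ k) (d k) with hF
  have hIL : MemLp I 2 μ := memLp_incrementSum hw _ _ _ _
  have hFL : MemLp F 2 volume := memLp_intervalSum _ _ _ _
  have hfi : AEStronglyMeasurable ((Set.Ioc 0 u).indicator f) volume :=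
    hf.indicator measurableSet_Ioc
  have e1 : incrementSum w S p q c - X = (incrementSum w S p q c - I) - (X - I) := by abel
  have e2 : intervalSum S p q c - F = (intervalSum S p q c - (Set.Ioc 0 u).indicator f) +
      ((Set.Ioc 0 u).indicator f - F) := by abel
  -- The partition ends exactly at `u`, so `F` vanishes off `(0, u]` and the error on `(0, u]` is
  -- the error on the whole line.
  have e3 : (Set.Ioc 0 u).indicator f - F = (Set.Ioc 0 u).indicator (fun θ => f θ - F θ) := by
    ext θ
    by_cases hθ : θ ∈ Set.Ioc 0 u
    · simp [hθ]
    · have : F θ = 0 := stepFun_eq_zero_of_notMem hm _ (by rwa [hu])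
      simp [hθ, this]
  calc eLpNorm (incrementSum w S p q c - X) 2 μ
      ≤ eLpNorm (incrementSum w S p q c - I) 2 μ + eLpNorm (X - I) 2 μ := by
        rw [e1]
        exact eLpNorm_sub_le ((memLp_incrementSum hw S p q c).sub hIL).1 (hX.memLp.sub hIL).1
          (by norm_num)
    _ = eLpNorm (intervalSum S p q c - F) 2 volume + eLpNorm (X - I) 2 μ := by
        rw [hI, hF, stepIntegral_eq_incrementSum, stepFun_eq_intervalSum,
          eLpNorm_incrementSum_sub hw S hpq c _ fun i _ => hm (Nat.le_succ i)]
    _ ≤ _ := by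
        refine add_le_add ?_ le_rfl
        rw [e2, ← eLpNorm_indicator_eq_eLpNorm_restrict measurableSet_Ioc, ← e3]
        exact eLpNorm_add_le ((memLp_intervalSum S p q c).1.sub hfi) (hfi.sub hFL.1) (by norm_num)

end isometry

/-! ### Uniform grids and the `L²` error of their step functions -/

lemma intervalSum_eq_of_mem {τ : ℕ → ℝ≥0} (hτ : Monotone τ) (S : Finset ℕ) (c : ℕ → ℝ) {i : ℕ}
    {θ : ℝ} (hθ : θ ∈ Set.Ioc (τ i : ℝ) (τ (i + 1))) :
    intervalSum S τ (fun j => τ (j + 1)) c θ = if i ∈ S then c i else 0 := by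
  have hd : Monotone fun j => (τ j : ℝ) := fun _ _ h => NNReal.coe_le_coe.2 (hτ h)
  have key : ∀ j, j ≠ i → θ ∉ Set.Ioc (τ j : ℝ) (τ (j + 1)) := fun j hj h =>
    Set.disjoint_left.1 (hd.pairwise_disjoint_on_Ioc_succ hj) h hθ
  unfold intervalSum
  split_ifs with hi
  · rw [Finset.sum_eq_single_of_mem i hi fun j _ hj => Set.indicator_of_notMem (key j hj) _,
      Set.indicator_of_mem hθ]
  · exact Finset.sum_eq_zero fun j hj =>
      Set.indicator_of_notMem (key j fun h => hi (h ▸ hj)) _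

lemma node_nonneg {L : ℝ} (hL : 0 ≤ L) (N j : ℕ) : 0 ≤ node L N j := by
  unfold node; positivity

lemma node_mono {L : ℝ} (hL : 0 ≤ L) (N : ℕ) : Monotone (node L N) := fun i j h => by
  unfold node
  gcongr

lemma node_succ (L : ℝ) (N j : ℕ) : node L N (j + 1) = node L N j + L / N := by
  simp [node]; ring

lemma node_self (L : ℝ) {N : ℕ} (hN : N ≠ 0) : node L N N = L := by
  unfold node; field_simp

lemma node_mem_Icc {L : ℝ} (hL : 0 ≤ L) {N : ℕ} (hN : N ≠ 0) {j : ℕ} (hj : j ≤ N) :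
    node L N j ∈ Set.Icc 0 L :=
  ⟨node_nonneg hL N j, (node_mono hL N hj).trans_eq (node_self L hN)⟩

lemma exists_mem_Ioc_node {L : ℝ} (hL : 0 < L) {N : ℕ} (hN : N ≠ 0) {θ : ℝ} (hθ : 0 < θ) :
    ∃ i, θ ∈ Set.Ioc (node L N i) (node L N (i + 1)) := by
  have hΔ : 0 < L / N := by positivity
  have h0 : ⌈θ / (L / N)⌉₊ ≠ 0 := (Nat.ceil_pos.2 (by positivity)).ne'
  obtain ⟨i, hi⟩ := Nat.exists_eq_succ_of_ne_zero h0
  refine ⟨i, ?_, ?_⟩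
  · exact (lt_div_iff₀ hΔ).1 (Nat.lt_ceil.1 (by omega))
  · refine (div_le_iff₀ hΔ).1 ((Nat.le_ceil _).trans_eq ?_)
    rw [hi]

/-- The elementary angle process driven by an arbitrary intensity `f`. -/
noncomputable def gridSum {Ω : Type*} (w : ℝ≥0 → Ω → ℝ) (f : ℝ → ℝ) (L : ℝ) (N s : ℕ) : Ω → ℝ :=
  incrementSum w (Finset.Icc 1 s) (fun j => (node L N j).toNNReal)
    (fun j => (node L N (j + 1)).toNNReal) (fun j => f (node L N j))

/-- The step function whose elementary integral is `gridSum`. -/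
noncomputable def gridFun (f : ℝ → ℝ) (L : ℝ) (N s : ℕ) : ℝ → ℝ :=
  intervalSum (Finset.Icc 1 s) (fun j => (node L N j).toNNReal)
    (fun j => (node L N (j + 1)).toNNReal) (fun j => f (node L N j))

lemma toNNReal_node_mono {L : ℝ} (hL : 0 ≤ L) (N : ℕ) :
    Monotone fun j => (node L N j).toNNReal :=
  fun _ _ h => Real.toNNReal_mono (node_mono hL N h)

lemma gridFun_eq_of_mem {L : ℝ} (hL : 0 ≤ L) (f : ℝ → ℝ) (N s : ℕ) {i : ℕ} {θ : ℝ}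
    (hθ : θ ∈ Set.Ioc (node L N i) (node L N (i + 1))) :
    gridFun f L N s θ = if i ∈ Finset.Icc 1 s then f (node L N i) else 0 :=
  intervalSum_eq_of_mem (toNNReal_node_mono hL N) _ _ (by
    rwa [Real.coe_toNNReal _ (node_nonneg hL _ _), Real.coe_toNNReal _ (node_nonneg hL _ _)])

lemma gridFun_eq_zero (f : ℝ → ℝ) (L : ℝ) (N s : ℕ) {θ : ℝ} (hθ : θ ≤ 0) :
    gridFun f L N s θ = 0 := by
  unfold gridFun intervalSum
  refine Finset.sum_eq_zero fun i _ => Set.indicator_of_notMem (fun h => ?_) _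
  exact ((Real.toNNReal (node L N i)).coe_nonneg.trans_lt h.1).not_ge hθ

/-- The three terms are the oscillation of `f` within a cell, the first cell (which the sum from `j
= 1` omits), and the overshoot of the last cells beyond `u`. -/
lemma abs_gridFun_sub_le {L : ℝ} (hL : 0 < L) {N : ℕ} (hN : N ≠ 0) {f : ℝ → ℝ} {M η : ℝ}
    (hM : ∀ x, |f x| ≤ M) (hη : 0 ≤ η) (hf : ∀ x y, |x - y| ≤ L / N → |f x - f y| ≤ η) {u : ℝ}
    (hu : u ∈ Set.Icc 0 L) {s : ℕ} (hs : |node L N s - u| ≤ L / N) (θ : ℝ) :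
    ‖(gridFun f L N s - (Set.Ioc 0 u).indicator f) θ‖ ≤
      (Set.Ioc 0 L).indicator (fun _ => η) θ + (Set.Ioc 0 (L / N)).indicator (fun _ => M) θ +
        (Set.Ioc (u - 2 * (L / N)) (u + 2 * (L / N))).indicator (fun _ => M) θ := by
  have hM0 : 0 ≤ M := (abs_nonneg _).trans (hM 0)
  have hΔ : 0 < L / N := by positivity
  have p1 : 0 ≤ (Set.Ioc 0 L).indicator (fun _ => η) θ := Set.indicator_nonneg (fun _ _ => hη) _
  have p2 : 0 ≤ (Set.Ioc 0 (L / N)).indicator (fun _ => M) θ :=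
    Set.indicator_nonneg (fun _ _ => hM0) _
  have p3 : 0 ≤ (Set.Ioc (u - 2 * (L / N)) (u + 2 * (L / N))).indicator (fun _ => M) θ :=
    Set.indicator_nonneg (fun _ _ => hM0) _
  rw [Pi.sub_apply, Real.norm_eq_abs]
  rcases le_or_gt θ 0 with h0 | h0
  · rw [gridFun_eq_zero f L N s h0, Set.indicator_of_notMem fun h => h0.not_gt h.1]
    simpa using by positivity
  obtain ⟨i, hi⟩ := exists_mem_Ioc_node hL hN h0
  rw [gridFun_eq_of_mem hL.le f N s hi]
  have hns := node_succ L N i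
  obtain ⟨hi1, hi2⟩ := hi
  obtain ⟨hs1, hs2⟩ := abs_le.1 hs
  rcases Nat.eq_zero_or_pos i with rfl | hipos
  · have hθ : θ ∈ Set.Ioc 0 (L / N) := ⟨h0, by simpa [node] using hi2⟩
    have e : (if 0 ∈ Finset.Icc 1 s then f (node L N 0) else 0) = 0 := by simp
    rw [e, Set.indicator_of_mem hθ (fun _ => M), zero_sub, abs_neg]
    have : |(Set.Ioc 0 u).indicator f θ| ≤ M := by
      by_cases h : θ ∈ Set.Ioc 0 u <;> simp [h, hM, hM0]
    linarith
  by_cases his : i ≤ s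
  · rw [if_pos (Finset.mem_Icc.2 ⟨hipos, his⟩)]
    by_cases hθu : θ ≤ u
    · rw [Set.indicator_of_mem (s := Set.Ioc 0 u) ⟨h0, hθu⟩,
        Set.indicator_of_mem (s := Set.Ioc 0 L) ⟨h0, hθu.trans hu.2⟩]
      have : |f (node L N i) - f θ| ≤ η := hf _ _ (by rw [abs_le]; constructor <;> linarith)
      linarith
    -- Overshoot: `θ ≤ l_{i+1} ≤ l_s + Δ ≤ u + 2Δ`.
    · have := node_mono hL.le N his
      rw [Set.indicator_of_notMem (s := Set.Ioc 0 u) fun h => hθu h.2, sub_zero,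
        Set.indicator_of_mem (s := Set.Ioc (u - 2 * (L / N)) (u + 2 * (L / N)))
          ⟨by linarith, by linarith⟩]
      linarith [hM (node L N i)]
  -- Past the last cell `θ > l_{s+1} = l_s + Δ ≥ u`, so both functions vanish.
  · rw [if_neg fun h => his (Finset.mem_Icc.1 h).2]
    have := node_mono hL.le N (show s + 1 ≤ i by omega)
    rw [node_succ] at this
    rw [Set.indicator_of_notMem (s := Set.Ioc 0 u) fun h => by linarith [h.2]]
    simpa using by positivity

lemma eLpNorm_le_of_norm_le_indicators {L Δ M η u : ℝ} (hM : 0 ≤ M) (hη : 0 ≤ η) {h : ℝ → ℝ}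
    (hh : ∀ θ, ‖h θ‖ ≤ (Set.Ioc 0 L).indicator (fun _ => η) θ +
      (Set.Ioc 0 Δ).indicator (fun _ => M) θ +
        (Set.Ioc (u - 2 * Δ) (u + 2 * Δ)).indicator (fun _ => M) θ) :
    eLpNorm h 2 volume ≤ ENNReal.ofReal η * ENNReal.ofReal L ^ (1 / 2 : ℝ) +
      (ENNReal.ofReal M * ENNReal.ofReal Δ ^ (1 / 2 : ℝ) +
        ENNReal.ofReal M * ENNReal.ofReal (4 * Δ) ^ (1 / 2 : ℝ)) := by
  have hI := fun a b c => (memLp_indicator_Ioc a b c).1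
  have hN : ∀ a b c, 0 ≤ c → eLpNorm ((Set.Ioc a b).indicator fun _ => c) 2 volume =
      ENNReal.ofReal c * ENNReal.ofReal (b - a) ^ (1 / 2 : ℝ) := fun a b c hc => by
    rw [eLpNorm_indicator_const measurableSet_Ioc (by simp) (by simp), Real.volume_Ioc,
      Real.enorm_of_nonneg hc]
    simp
  refine (eLpNorm_mono_real (g := (Set.Ioc 0 L).indicator (fun _ => η) +
      (Set.Ioc 0 Δ).indicator (fun _ => M) +
        (Set.Ioc (u - 2 * Δ) (u + 2 * Δ)).indicator (fun _ => M)) hh).trans ?_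
  refine (eLpNorm_add_le ((hI _ _ _).add (hI _ _ _)) (hI _ _ _) (by norm_num)).trans ?_
  refine (add_le_add_left (eLpNorm_add_le (hI _ _ _) (hI _ _ _) (by norm_num)) _).trans ?_
  rw [hN _ _ _ hη, hN _ _ _ hM, hN _ _ _ hM, add_assoc, sub_zero, sub_zero,
    show u + 2 * Δ - (u - 2 * Δ) = 4 * Δ by ring]

lemma tendsto_div_natCast (L : ℝ) : Tendsto (fun N : ℕ => L / N) atTop (𝓝 0) :=
  tendsto_const_nhds.div_atTop tendsto_natCast_atTop_atTop

lemma eventually_abs_sub_le {f : ℝ → ℝ} (hf : UniformContinuous f) (L : ℝ) {η : ℝ} (hη : 0 < η) :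
    ∀ᶠ N : ℕ in atTop, N ≠ 0 ∧ ∀ x y, |x - y| ≤ L / N → |f x - f y| ≤ η := by
  obtain ⟨δ, hδ, h⟩ := Metric.uniformContinuous_iff.1 hf η hη
  filter_upwards [(tendsto_div_natCast L).eventually (gt_mem_nhds hδ), eventually_ne_atTop 0]
    with N hN h0
  exact ⟨h0, fun x y hxy => (h (hxy.trans_lt hN)).le⟩

lemma exists_ofReal_mul_le {c ε : ℝ≥0∞} (hc : c ≠ ∞) (hε : ε ≠ 0) :
    ∃ η : ℝ, 0 < η ∧ ENNReal.ofReal η * c ≤ ε := by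
  have h : Tendsto (fun η : ℝ => ENNReal.ofReal η * c) (𝓝[>] 0) (𝓝 0) := by
    have := ENNReal.Tendsto.mul_const (b := c)
      (ENNReal.tendsto_ofReal (tendsto_nhdsWithin_of_tendsto_nhds (s := Set.Ioi 0)
        (tendsto_id (x := 𝓝 (0 : ℝ))))) (Or.inr hc)
    simpa using this
  obtain ⟨η, h1, h2⟩ := ((h.eventually (ge_mem_nhds hε.bot_lt)).and self_mem_nhdsWithin).exists
  exact ⟨η, h2, h1⟩

lemma eventually_eLpNorm_gridFun_sub_le {f : ℝ → ℝ} (hf : UniformContinuous f) {M : ℝ}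
    (hM : ∀ x, |f x| ≤ M) {L : ℝ} (hL : 0 < L) {ε : ℝ≥0∞} (hε : ε ≠ 0) :
    ∀ᶠ N : ℕ in atTop, ∀ u ∈ Set.Icc 0 L, ∀ s, |node L N s - u| ≤ L / N →
      eLpNorm (gridFun f L N s - (Set.Ioc 0 u).indicator f) 2 volume ≤ ε := by
  obtain ⟨η, hη, hηε⟩ := exists_ofReal_mul_le (c := ENNReal.ofReal L ^ (1 / 2 : ℝ)) (ε := ε / 2)
    (ENNReal.rpow_ne_top_of_nonneg (by norm_num) ENNReal.ofReal_ne_top)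
    (ENNReal.half_pos hε).ne'
  have hlim : Tendsto (fun N : ℕ => ENNReal.ofReal M * ENNReal.ofReal (L / N) ^ (1 / 2 : ℝ) +
      ENNReal.ofReal M * ENNReal.ofReal (4 * (L / N)) ^ (1 / 2 : ℝ)) atTop (𝓝 0) := by
    have h : ∀ c : ℝ, Tendsto (fun N : ℕ => ENNReal.ofReal M *
        ENNReal.ofReal (c * (L / N)) ^ (1 / 2 : ℝ)) atTop (𝓝 0) := fun c => by
      have h1 := ENNReal.tendsto_ofReal ((tendsto_div_natCast L).const_mul c)
      have h2 := (ENNReal.continuous_rpow_const (y := 1 / 2)).tendsto _ |>.comp h1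
      have h3 := ENNReal.Tendsto.const_mul (a := ENNReal.ofReal M) h2
        (Or.inr ENNReal.ofReal_ne_top)
      simpa [Function.comp_def] using h3
    simpa using (h 1).add (h 4)
  filter_upwards [eventually_abs_sub_le hf L hη,
    hlim.eventually (ge_mem_nhds (ENNReal.half_pos hε))] with N hN hN' u hu s hs
  refine (eLpNorm_le_of_norm_le_indicators ((abs_nonneg _).trans (hM 0)) hη.le
    (abs_gridFun_sub_le hL hN.1 hM hη.le hN.2 hu hs)).trans ?_
  exact (add_le_add hηε hN').trans_eq (ENNReal.add_halves ε)

/-! ### Partitions stopped at `u` -/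

/-- The points of the uniform grid of mesh `L / N`, stopped at `u`. -/
noncomputable def stoppedNode (L : ℝ) (N : ℕ) (u : ℝ) (i : ℕ) : ℝ≥0 :=
  (min (node L N i) u).toNNReal

lemma stoppedNode_mono {L : ℝ} (hL : 0 ≤ L) (N : ℕ) (u : ℝ) : Monotone (stoppedNode L N u) :=
  fun _ _ h => Real.toNNReal_mono (min_le_min_right _ (node_mono hL N h))

lemma coe_stoppedNode {L : ℝ} (hL : 0 ≤ L) (N : ℕ) {u : ℝ} (hu : 0 ≤ u) (i : ℕ) :
    (stoppedNode L N u i : ℝ) = min (node L N i) u :=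
  Real.coe_toNNReal _ (le_min (node_nonneg hL N i) hu)

lemma coe_stoppedNode_self {L : ℝ} (hL : 0 ≤ L) {N : ℕ} (hN : N ≠ 0) {u : ℝ}
    (hu : u ∈ Set.Icc 0 L) : (stoppedNode L N u N : ℝ) = u := by
  rw [coe_stoppedNode hL N hu.1, node_self L hN, min_eq_right hu.2]

lemma eventually_eLpNorm_stepFun_sub_le {f : ℝ → ℝ} (hf : UniformContinuous f)
    {L : ℝ} (hL : 0 < L) {u : ℝ} (hu : u ∈ Set.Icc 0 L) {ε : ℝ≥0∞}
    (hε : ε ≠ 0) :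
    ∀ᶠ N : ℕ in atTop,
      eLpNorm (stepFun N (stoppedNode L N u) (fun i => f (node L N i)) -
        (Set.Ioc 0 u).indicator f) 2 volume ≤ ε := by
  obtain ⟨η, hη, hηε⟩ := exists_ofReal_mul_le (c := ENNReal.ofReal L ^ (1 / 2 : ℝ)) (ε := ε)
    (ENNReal.rpow_ne_top_of_nonneg (by norm_num) ENNReal.ofReal_ne_top) hε
  filter_upwards [eventually_abs_sub_le hf L hη] with N hN
  obtain ⟨hN0, hN⟩ := hN
  refine le_trans ?_ hηε
  -- A stopped partition starts at 0 and ends at `u`, so there are no edge errors: `Δ = M = 0`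
  -- removes those terms.
  have := eLpNorm_le_of_norm_le_indicators (L := L) (Δ := 0) (M := 0) (η := η) (u := 0) le_rfl
    hη.le (h := stepFun N (stoppedNode L N u) (fun i => f (node L N i)) -
        (Set.Ioc 0 u).indicator f) fun θ => ?_
  · simpa using this
  simp only [Pi.sub_apply, Set.indicator_zero, add_zero]
  by_cases hθ : θ ∈ Set.Ioc 0 u
  · obtain ⟨i, hi⟩ := exists_mem_Ioc_node hL hN0 hθ.1
    have hi' : θ ∈ Set.Ioc (stoppedNode L N u i : ℝ) (stoppedNode L N u (i + 1)) := by
      rw [coe_stoppedNode hL.le N hu.1, coe_stoppedNode hL.le N hu.1]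
      exact ⟨(min_le_left _ _).trans_lt hi.1, le_min hi.2 hθ.2⟩
    have hiN : i ∈ Finset.range N := by
      rw [Finset.mem_range]
      by_contra! h
      have h1 := node_mono hL.le N h
      rw [node_self L hN0] at h1
      linarith [hi.1, hθ.2, hu.2]
    rw [stepFun_eq_intervalSum, intervalSum_eq_of_mem (stoppedNode_mono hL.le N u) _ _ hi',
      if_pos hiN, Set.indicator_of_mem hθ,
      Set.indicator_of_mem (s := Set.Ioc 0 L) ⟨hθ.1, hθ.2.trans hu.2⟩]
    have := node_succ L N i
    exact hN _ _ (by rw [abs_le]; constructor <;> linarith [hi.1, hi.2])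
  · rw [stepFun_eq_zero_of_notMem (stoppedNode_mono hL.le N u) _
      (by rwa [coe_stoppedNode_self hL.le hN0 hu]), Set.indicator_of_notMem hθ]
    simpa using Set.indicator_nonneg (fun _ _ => hη.le) _

/-! ### Existence of a jointly measurable Wiener integral process -/

section existence

variable {Ω : Type*} [MeasurableSpace Ω] {μ : Measure Ω} {w : ℝ≥0 → Ω → ℝ}

lemma abs_node_floor_sub_le {L : ℝ} (hL : 0 < L) {N : ℕ} (hN : N ≠ 0) {u : ℝ} (hu : 0 ≤ u) :
    |node L N ⌊u / (L / N)⌋₊ - u| ≤ L / N := by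
  have hΔ : 0 < L / N := by positivity
  have h1 := (le_div_iff₀ hΔ).1 (Nat.floor_le (show 0 ≤ u / (L / N) by positivity))
  have h2 := (div_lt_iff₀ hΔ).1 (Nat.lt_floor_add_one (u / (L / N)))
  rw [abs_le, node]
  constructor <;> linarith

lemma memLp_gridFun (f : ℝ → ℝ) (L : ℝ) (N s : ℕ) : MemLp (gridFun f L N s) 2 volume :=
  memLp_intervalSum _ _ _ _

lemma memLp_gridSum (hw : IsPreBrownianReal w μ) (f : ℝ → ℝ) (L : ℝ) (N s : ℕ) :
    MemLp (gridSum w f L N s) 2 μ :=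
  memLp_incrementSum hw _ _ _ _

lemma eLpNorm_two_sub_le_add {α : Type*} [MeasurableSpace α] {ν : Measure α} {f g h : α → ℝ}
    (hf : AEStronglyMeasurable f ν) (hg : AEStronglyMeasurable g ν)
    (hh : AEStronglyMeasurable h ν) :
    eLpNorm (f - g) 2 ν ≤ eLpNorm (f - h) 2 ν + eLpNorm (g - h) 2 ν := by
  rw [show f - g = (f - h) - (g - h) by abel]
  exact eLpNorm_sub_le (hf.sub hh) (hg.sub hh) (by norm_num)

/-- A mean-square limit of elementary integrals on uniform grids is a Wiener integral. -/
lemma isWienerIntegral_of_tendsto (hw : IsPreBrownianReal w μ) {f : ℝ → ℝ}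
    (hf : UniformContinuous f) {L : ℝ} (hL : 0 < L) {u : ℝ} (hu : u ∈ Set.Icc 0 L) {X : Ω → ℝ}
    (hX : AEStronglyMeasurable X μ) {N s : ℕ → ℕ}
    (hF : Tendsto (fun k => eLpNorm (gridFun f L (N k) (s k) - (Set.Ioc 0 u).indicator f) 2 volume)
      atTop (𝓝 0))
    (hI : Tendsto (fun k => eLpNorm (gridSum w f L (N k) (s k) - X) 2 μ) atTop (𝓝 0)) :
    IsWienerIntegral μ w f u X := by
  have hfi : AEStronglyMeasurable ((Set.Ioc 0 u).indicator f) volume :=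
    hf.continuous.aestronglyMeasurable.indicator measurableSet_Ioc
  -- Grid sums omit the first cell and may overshoot `u`, so they are not subordinate to partitions
  -- of `[0, u]`; the stopped partitions serve as the approximants instead.
  set S : ℕ → ℝ → ℝ :=
    fun k => stepFun (k + 1) (stoppedNode L (k + 1) u) (fun i => f (node L (k + 1) i)) with hS
  set J : ℕ → Ω → ℝ :=
    fun k => stepIntegral w (k + 1) (stoppedNode L (k + 1) u) (fun i => f (node L (k + 1) i))
    with hJ
  have hSL : ∀ k, MemLp (S k) 2 volume := fun k => memLp_intervalSum _ _ _ _
  have hJL : ∀ k, MemLp (J k) 2 μ := fun k => memLp_incrementSum hw _ _ _ _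
  have hSt : Tendsto (fun k => eLpNorm (S k - (Set.Ioc 0 u).indicator f) 2 volume) atTop (𝓝 0) := by
    refine ENNReal.tendsto_nhds_zero.2 fun ε hε => ?_
    exact (tendsto_add_atTop_nat 1).eventually
      (eventually_eLpNorm_stepFun_sub_le hf hL hu hε.ne')
  -- The isometry passes to the limit: compare `J k` with the j-th grid sum, then let `j` tend to
  -- infinity.
  have hle : ∀ k, eLpNorm (X - J k) 2 μ ≤
      eLpNorm (S k - (Set.Ioc 0 u).indicator f) 2 volume := fun k => by
    have hlim : Tendsto (fun j => eLpNorm (gridSum w f L (N j) (s j) - X) 2 μ +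
        (eLpNorm (gridFun f L (N j) (s j) - (Set.Ioc 0 u).indicator f) 2 volume +
          eLpNorm (S k - (Set.Ioc 0 u).indicator f) 2 volume)) atTop
        (𝓝 (0 + (0 + eLpNorm (S k - (Set.Ioc 0 u).indicator f) 2 volume))) :=
      hI.add (hF.add tendsto_const_nhds)
    simp only [zero_add] at hlim
    refine ge_of_tendsto' hlim fun j => ?_
    have hG := (memLp_gridSum hw f L (N j) (s j)).1
    calc eLpNorm (X - J k) 2 μ
        ≤ eLpNorm (X - gridSum w f L (N j) (s j)) 2 μ +
          eLpNorm (J k - gridSum w f L (N j) (s j)) 2 μ :=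
            eLpNorm_two_sub_le_add hX (hJL k).1 hG
      _ = eLpNorm (gridSum w f L (N j) (s j) - X) 2 μ +
          eLpNorm (gridFun f L (N j) (s j) - S k) 2 volume := by
        rw [eLpNorm_sub_comm, eLpNorm_sub_comm (J k)]
        congr 1
        exact eLpNorm_incrementSum_sub hw _
          (fun i _ => toNNReal_node_mono hL.le (N j) (Nat.le_succ i)) _ _
          (fun i _ => stoppedNode_mono hL.le (k + 1) u (Nat.le_succ i)) _
      _ ≤ _ := by
        gcongr
        exact eLpNorm_two_sub_le_add (memLp_gridFun f L _ _).1 (hSL k).1 hfi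
  have hJt : Tendsto (fun k => eLpNorm (X - J k) 2 μ) atTop (𝓝 0) :=
    tendsto_of_tendsto_of_tendsto_of_le_of_le tendsto_const_nhds hSt (fun _ => zero_le) hle
  refine ⟨?_, fun k => k + 1, fun k => stoppedNode L (k + 1) u,
    fun k i => f (node L (k + 1) i), fun k => ⟨stoppedNode_mono hL.le _ _, ?_, ?_⟩, ?_, hJt⟩
  · have : MemLp (X - J 0) 2 μ :=
      ⟨hX.sub (hJL 0).1, (hle 0).trans_lt ?_⟩
    · simpa using this.add (hJL 0)
    · have hfL : MemLp ((Set.Ioc 0 u).indicator f) 2 volume := by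
        rw [memLp_indicator_iff_restrict measurableSet_Ioc]
        obtain ⟨C, hC⟩ := isCompact_Icc.exists_bound_of_continuousOn
          (hf.continuous.continuousOn (s := Set.Icc 0 u))
        exact MemLp.of_bound hf.continuous.aestronglyMeasurable C
          (ae_restrict_of_forall_mem measurableSet_Ioc fun θ hθ =>
            hC θ (Set.Ioc_subset_Icc_self hθ))
      exact ((hSL 0).sub hfL).2
  · simp [stoppedNode, node, hu.1]
  · exact coe_stoppedNode_self hL.le (Nat.succ_ne_zero k) hu
  · refine hSt.congr fun k => ?_
    rw [eLpNorm_sub_comm, ← eLpNorm_indicator_eq_eLpNorm_restrict measurableSet_Ioc]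
    congr 1
    ext θ
    by_cases hθ : θ ∈ Set.Ioc 0 u
    · simp [hθ, hS]
    · have : S k θ = 0 := stepFun_eq_zero_of_notMem (stoppedNode_mono hL.le _ _) _
        (by rwa [coe_stoppedNode_self hL.le (Nat.succ_ne_zero k) hu])
      simp [hθ, this]

/-- The floor takes countably many values, so measurability in `ω` for each fixed number of links
suffices. -/
lemma measurable_gridSum_floor (hw : ∀ t, Measurable (w t)) (f : ℝ → ℝ) (L : ℝ) (N : ℕ) :
    Measurable fun z : ℝ × Ω => gridSum w f L N ⌊z.1 / (L / N)⌋₊ z.2 := by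
  have h : Measurable fun z : ℕ × Ω => gridSum w f L N z.1 z.2 :=
    measurable_from_prod_countable_right fun s => by
      simp only [gridSum, incrementSum]
      fun_prop
  exact h.comp ((Nat.measurable_floor.comp (measurable_fst.div_const _)).prodMk measurable_snd)

/-- A bounded uniformly continuous function has a jointly measurable Wiener integral process. -/
theorem exists_isWienerIntegralProcess (hw : IsPreBrownianReal w μ) {f : ℝ → ℝ}
    (hf : UniformContinuous f) {M : ℝ} (hM : ∀ x, |f x| ≤ M) {L : ℝ} (hL : 0 < L) :
    ∃ Y, IsWienerIntegralProcess μ w f L Y := by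
  have := hw.isGaussianProcess.isProbabilityMeasure
  -- Each `w t` is only a.e. measurable; joint measurability needs a modification with measurable
  -- values.
  set w' : ℝ≥0 → Ω → ℝ := fun t => (hw.aemeasurable t).mk (w t) with hw'
  have hww' : ∀ t, w t =ᵐ[μ] w' t := fun t => (hw.aemeasurable t).ae_eq_mk
  have hwm : ∀ t, Measurable (w' t) := fun t => (hw.aemeasurable t).measurable_mk
  have hpre : IsPreBrownianReal w' μ := hw.congr hww'
  have hB0 : ∀ k : ℕ, ((1 / 2 : ℝ≥0∞) ^ k) ≠ 0 := fun k => pow_ne_zero _ (by simp)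
  -- A quarter of `2⁻ᵏ`: two such errors add up to half of `2⁻ᵏ`, which leaves the strict Cauchy
  -- bound in `hcau`.
  have hε : ∀ k : ℕ, ((1 / 2 : ℝ≥0∞) ^ k) / 2 / 2 ≠ 0 := fun k =>
    (ENNReal.half_pos (ENNReal.half_pos (hB0 k)).ne').ne'
  choose N hN0 hN using fun k : ℕ => ((eventually_ne_atTop 0).and
    (eventually_eLpNorm_gridFun_sub_le hf hM hL (hε k))).exists
  set Z : ℕ → ℝ × Ω → ℝ := fun k z => gridSum w' f L (N k) ⌊z.1 / (L / N k)⌋₊ z.2 with hZ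
  have hZm : ∀ k, StronglyMeasurable (Z k) := fun k =>
    (measurable_gridSum_floor hwm f L (N k)).stronglyMeasurable
  have hYm := StronglyMeasurable.limUnder (l := atTop) hZm
  -- The grids `N k` do not depend on `u`, so a single pointwise limit serves all `u`; `limUnder`
  -- takes a junk value where the sequence diverges, which for each `u` is a null set of `ω`.
  refine ⟨fun u ω => limUnder atTop fun k => Z k (u, ω), hYm.aestronglyMeasurable,
    fun u hu => ?_⟩
  set s : ℕ → ℕ := fun k => ⌊u / (L / N k)⌋₊ with hs
  have hD := fun k => hN k u hu (s k) (abs_node_floor_sub_le hL (hN0 k) hu.1)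
  have hfi : AEStronglyMeasurable ((Set.Ioc 0 u).indicator f) volume :=
    hf.continuous.aestronglyMeasurable.indicator measurableSet_Ioc
  have hBsum : ∑' k : ℕ, (1 / 2 : ℝ≥0∞) ^ k ≠ ∞ := by
    rw [ENNReal.tsum_geometric, one_div, ENNReal.one_sub_inv_two]
    simp
  have hcau : ∀ K n m, K ≤ n → K ≤ m →
      eLpNorm (gridSum w' f L (N n) (s n) - gridSum w' f L (N m) (s m)) 2 μ <
        (1 / 2 : ℝ≥0∞) ^ K := fun K n m hn hm => by
    have hmon : ∀ n, K ≤ n → (1 / 2 : ℝ≥0∞) ^ n ≤ (1 / 2 : ℝ≥0∞) ^ K := fun n hn =>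
      pow_le_pow_right_of_le_one' (by simp) hn
    have hd : ∀ n, K ≤ n → eLpNorm (gridFun f L (N n) (s n) - (Set.Ioc 0 u).indicator f) 2 volume ≤
        (1 / 2 : ℝ≥0∞) ^ K / 2 / 2 := fun n hn => (hD n).trans (ENNReal.div_le_div_right (ENNReal.div_le_div_right (hmon n hn) _) _)
    calc eLpNorm (gridSum w' f L (N n) (s n) - gridSum w' f L (N m) (s m)) 2 μ
        = eLpNorm (gridFun f L (N n) (s n) - gridFun f L (N m) (s m)) 2 volume :=
          eLpNorm_incrementSum_sub hpre _
            (fun i _ => toNNReal_node_mono hL.le (N n) (Nat.le_succ i)) _ _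
            (fun i _ => toNNReal_node_mono hL.le (N m) (Nat.le_succ i)) _
      _ ≤ (1 / 2 : ℝ≥0∞) ^ K / 2 / 2 + (1 / 2 : ℝ≥0∞) ^ K / 2 / 2 :=
          (eLpNorm_two_sub_le_add (memLp_gridFun f L _ _).1 (memLp_gridFun f L _ _).1 hfi).trans
            (add_le_add (hd n hn) (hd m hm))
      _ = (1 / 2 : ℝ≥0∞) ^ K / 2 := ENNReal.add_halves _
      _ < (1 / 2 : ℝ≥0∞) ^ K := ENNReal.half_lt_self (hB0 K) (by simp)
  have hmeas := fun k => (memLp_gridSum hpre f L (N k) (s k)).1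
  have hae : ∀ᵐ ω ∂μ, Tendsto (fun k => gridSum w' f L (N k) (s k) ω) atTop
      (𝓝 (limUnder atTop fun k => Z k (u, ω))) := by
    filter_upwards [Lp.ae_tendsto_of_cauchy_eLpNorm hmeas (by norm_num) hBsum hcau] with ω hω
    exact tendsto_nhds_limUnder hω
  have hlim := Lp.cauchy_tendsto_of_tendsto hmeas _ hBsum hcau hae
  refine isWienerIntegral_of_tendsto (N := N) (s := s) hw hf hL hu
    (hYm.comp_measurable measurable_prodMk_left).aestronglyMeasurable ?_ ?_
  · refine tendsto_of_tendsto_of_tendsto_of_le_of_le tendsto_const_nhds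
      (ENNReal.tendsto_pow_atTop_nhds_zero_of_lt_one (show (1 / 2 : ℝ≥0∞) < 1 by simp))
      (fun _ => zero_le) fun k => (hD k).trans ?_
    exact ENNReal.half_le_self.trans ENNReal.half_le_self
  · refine hlim.congr fun k => eLpNorm_congr_ae ?_
    refine EventuallyEq.sub ?_ EventuallyEq.rfl
    -- Only countably many grid times occur, so `w'` can be replaced by `w` off one null set.
    have : ∀ᵐ ω ∂μ, ∀ j, w (node L (N k) j).toNNReal ω = w' (node L (N k) j).toNNReal ω :=
      ae_all_iff.2 fun j => hww' _
    filter_upwards [this] with ω hω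
    simp [gridSum, incrementSum, hω]

end existence

/-! ### Convergence in mean of the Riemann sums -/

section convergence

variable {Ω : Type*} [MeasurableSpace Ω] {μ : Measure Ω} {w : ℝ≥0 → Ω → ℝ}

/-- The Riemann sum of `a` times a function `φ` of the elementary angle process. -/
noncomputable def chainSum {Ω : Type*} (φ : ℝ → ℝ) (w : ℝ≥0 → Ω → ℝ) (a f : ℝ → ℝ) (L : ℝ)
    (N n : ℕ) (ω : Ω) : ℝ :=
  ∑ s ∈ Finset.Icc 1 n, a (node L N s) * φ (gridSum w f L N s ω) * (L / N)

lemma sum_Icc_one_eq_sum_range {M : Type*} [AddCommMonoid M] (g : ℕ → M) (n : ℕ) :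
    ∑ s ∈ Finset.Icc 1 n, g s = ∑ i ∈ Finset.range n, g (i + 1) := by
  induction n with
  | zero => simp
  | succ n ih => rw [Finset.sum_Icc_succ_top (by omega), ih, Finset.sum_range_succ]

/-- Split `bφ(X) - cφ(Y) = (b - c)φ(Y) + b(φ(X) - φ(Y))`; on a probability space the `L¹` norm of `X
- Y` is at most its `L²` norm. A general `φ` treats cos and sin together. -/
lemma lintegral_link_sub_le [IsProbabilityMeasure μ] {φ : ℝ → ℝ} (hφ : LipschitzWith 1 φ)
    (hφ1 : ∀ x, |φ x| ≤ 1) {b c A η : ℝ} (hb : |b| ≤ A) (hbc : |b - c| ≤ η) {X Y : Ω → ℝ}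
    (hX : AEStronglyMeasurable X μ) (hY : AEStronglyMeasurable Y μ) :
    ∫⁻ ω, ‖b * φ (X ω) - c * φ (Y ω)‖ₑ ∂μ ≤
      ENNReal.ofReal η + ENNReal.ofReal A * eLpNorm (X - Y) 2 μ := by
  have hA : 0 ≤ A := (abs_nonneg _).trans hb
  have hη : 0 ≤ η := (abs_nonneg _).trans hbc
  have h : ∀ ω, ‖b * φ (X ω) - c * φ (Y ω)‖ₑ ≤
      ENNReal.ofReal η + ENNReal.ofReal A * ‖(X - Y) ω‖ₑ := fun ω => by
    rw [Real.enorm_eq_ofReal_abs, Real.enorm_eq_ofReal_abs, ← ENNReal.ofReal_mul hA,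
      ← ENNReal.ofReal_add hη (by positivity)]
    refine ENNReal.ofReal_le_ofReal ?_
    have h1 : |φ (X ω) - φ (Y ω)| ≤ |X ω - Y ω| := by
      simpa [Real.dist_eq] using hφ.dist_le_mul (X ω) (Y ω)
    calc |b * φ (X ω) - c * φ (Y ω)|
        = |(b - c) * φ (Y ω) + b * (φ (X ω) - φ (Y ω))| := by ring_nf
      _ ≤ |b - c| * |φ (Y ω)| + |b| * |φ (X ω) - φ (Y ω)| := by
        rw [← abs_mul, ← abs_mul]; exact abs_add_le _ _
      _ ≤ η * 1 + A * |X ω - Y ω| := by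
        gcongr
        exact hφ1 _
      _ = _ := by rw [mul_one, Pi.sub_apply]
  refine (lintegral_mono h).trans ?_
  rw [lintegral_add_left measurable_const, lintegral_const, measure_univ, mul_one,
    lintegral_const_mul'' _ (hX.sub hY).enorm, ← eLpNorm_one_eq_lintegral_enorm]
  gcongr
  exact eLpNorm_le_eLpNorm_of_exponent_le (by norm_num) (hX.sub hY)

lemma IsWienerIntegralProcess.aestronglyMeasurable_mul_comp [SFinite μ] {f : ℝ → ℝ} {L : ℝ}
    {Y : ℝ → Ω → ℝ} (hY : IsWienerIntegralProcess μ w f L Y) {φ : ℝ → ℝ} (hφ : Continuous φ)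
    {a : ℝ → ℝ} (ha : Continuous a) :
    AEStronglyMeasurable (fun z : Ω × ℝ => a z.2 * φ (Y z.2 z.1))
      (μ.prod (volume.restrict (Set.Icc 0 L))) :=
  (ha.measurable.comp measurable_snd).aestronglyMeasurable.mul
    (hφ.comp_aestronglyMeasurable hY.aestronglyMeasurable.prod_swap)

lemma ae_integrableOn_of_abs_le [SFinite μ] {h : Ω × ℝ → ℝ} {L A : ℝ}
    (hh : AEStronglyMeasurable h (μ.prod (volume.restrict (Set.Icc 0 L)))) (hA : ∀ z, |h z| ≤ A) :
    ∀ᵐ ω ∂μ, IntegrableOn (fun u => h (ω, u)) (Set.Icc 0 L) := by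
  filter_upwards [hh.prodMk_left] with ω hω
  exact IntegrableOn.of_bound measure_Icc_lt_top hω A (ae_of_all _ fun u => hA (ω, u))

lemma aestronglyMeasurable_intervalIntegral [SFinite μ] {h : Ω × ℝ → ℝ} {L l : ℝ}
    (hh : AEStronglyMeasurable h (μ.prod (volume.restrict (Set.Icc 0 L))))
    (hl : l ∈ Set.Icc 0 L) :
    AEStronglyMeasurable (fun ω => ∫ u in (0 : ℝ)..l, h (ω, u)) μ := by
  simp only [intervalIntegral.integral_of_le hl.1]
  refine AEStronglyMeasurable.integral_prod_right' (hh.mono_measure ?_)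
  gcongr
  exact fun u hu => ⟨hu.1.le, hu.2.trans hl.2⟩

/-- A bound in mean on the distance between the Riemann sum and the integral. -/
lemma lintegral_chainSum_sub_le [IsProbabilityMeasure μ] (hw : IsPreBrownianReal w μ)
    {φ : ℝ → ℝ} (hφ : LipschitzWith 1 φ) (hφ1 : ∀ x, |φ x| ≤ 1) {a f : ℝ → ℝ} {A η : ℝ}
    {ε : ℝ≥0∞} (ha : Continuous a) (hA : ∀ x, |a x| ≤ A) (hf : Continuous f) {L : ℝ} (hL : 0 < L)
    {Y : ℝ → Ω → ℝ} (hY : IsWienerIntegralProcess μ w f L Y) {N n : ℕ} (hN : N ≠ 0) (hn : n ≤ N)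
    (hη : ∀ x y, |x - y| ≤ L / N → |a x - a y| ≤ η)
    (hε : ∀ u ∈ Set.Icc 0 L, ∀ s, |node L N s - u| ≤ L / N →
      eLpNorm (gridFun f L N s - (Set.Ioc 0 u).indicator f) 2 volume ≤ ε)
    {l : ℝ} (hl : l ∈ Set.Icc 0 L) :
    ∫⁻ ω, ‖chainSum φ w a f L N n ω - ∫ u in (0 : ℝ)..l, a u * φ (Y u ω)‖ₑ ∂μ ≤
      ENNReal.ofReal L * (ENNReal.ofReal η + ENNReal.ofReal A * ε) +
        ENNReal.ofReal (A * |node L N n - l|) := by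
  have hΔ : 0 < L / N := by positivity
  have hA0 : 0 ≤ A := (abs_nonneg _).trans (hA 0)
  have hH := hY.aestronglyMeasurable_mul_comp hφ.continuous ha
  have hbd : ∀ x y, |a x * φ y| ≤ A := fun x y => by
    rw [abs_mul]
    exact (mul_le_mul (hA x) (hφ1 y) (abs_nonneg _) hA0).trans_eq (mul_one A)
  have hnode := fun i (hi : i ≤ N) => node_mem_Icc hL.le hN hi
  set J : ℕ → Set ℝ := fun i => Set.Ioc (node L N i) (node L N (i + 1)) with hJ
  have hJL : ∀ i < n, J i ⊆ Set.Icc 0 L := fun i hi u hu =>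
    ⟨(hnode i (by omega)).1.trans hu.1.le, hu.2.trans (hnode (i + 1) (by omega)).2⟩
  -- The link `i + 1`, placed at the right end of the cell, is compared with the continuum integrand
  -- on `(l_i, l_{i+1}]`.
  set D : ℕ → Ω → ℝ → ℝ := fun i ω u =>
    a (node L N (i + 1)) * φ (gridSum w f L N (i + 1) ω) - a u * φ (Y u ω) with hD
  have hpath : ∀ᵐ ω ∂μ, ‖chainSum φ w a f L N n ω - ∫ u in (0 : ℝ)..l, a u * φ (Y u ω)‖ₑ ≤
      (∑ i ∈ Finset.range n, ∫⁻ u in J i, ‖D i ω u‖ₑ) + ENNReal.ofReal (A * |node L N n - l|) := by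
    filter_upwards [ae_integrableOn_of_abs_le hH fun z => hbd _ _] with ω hω
    have hint : ∀ x ∈ Set.Icc 0 L, ∀ y ∈ Set.Icc 0 L,
        IntervalIntegrable (fun u => a u * φ (Y u ω)) volume x y := fun x hx y hy =>
      (hω.mono_set (Set.uIcc_subset_Icc hx hy)).intervalIntegrable
    have h0 : (0 : ℝ) ∈ Set.Icc 0 L := ⟨le_rfl, hL.le⟩
    have e1 : ∫ u in (0 : ℝ)..l, a u * φ (Y u ω) =
        (∑ i ∈ Finset.range n, ∫ u in node L N i..node L N (i + 1), a u * φ (Y u ω)) +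
          ∫ u in node L N n..l, a u * φ (Y u ω) := by
      rw [intervalIntegral.sum_integral_adjacent_intervals fun k hk =>
          hint _ (hnode k (by omega)) _ (hnode (k + 1) (by omega)),
        show node L N 0 = 0 by simp [node],
        intervalIntegral.integral_add_adjacent_intervals (hint _ h0 _ (hnode n hn))
          (hint _ (hnode n hn) _ hl)]
    have e2 : chainSum φ w a f L N n ω - ∫ u in (0 : ℝ)..l, a u * φ (Y u ω) =
        (∑ i ∈ Finset.range n, ∫ u in J i, D i ω u) -
          ∫ u in node L N n..l, a u * φ (Y u ω) := by
      rw [e1, chainSum, sum_Icc_one_eq_sum_range, ← sub_sub, ← Finset.sum_sub_distrib]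
      congr 1
      refine Finset.sum_congr rfl fun i hi => ?_
      have hi := Finset.mem_range.1 hi
      rw [← intervalIntegral.integral_of_le (node_mono hL.le N i.le_succ),
        intervalIntegral.integral_sub intervalIntegrable_const
          (hint _ (hnode i (by omega)) _ (hnode (i + 1) (by omega))),
        intervalIntegral.integral_const, node_succ, add_sub_cancel_left, smul_eq_mul]
      ring
    rw [e2]
    refine enorm_sub_le.trans (add_le_add ((enorm_sum_le _ _).trans
      (Finset.sum_le_sum fun i _ => enorm_integral_le_lintegral_enorm _)) ?_)
    rw [← ofReal_norm, abs_sub_comm]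
    exact ENNReal.ofReal_le_ofReal
      (intervalIntegral.norm_integral_le_of_norm_le_const fun u _ => hbd _ _)
  have hDm : ∀ i < n, AEMeasurable (fun z : Ω × ℝ => ‖D i z.1 z.2‖ₑ)
      (μ.prod (volume.restrict (J i))) := fun i hi => by
    have h1 : AEStronglyMeasurable (fun z : Ω × ℝ => a (node L N (i + 1)) *
        φ (gridSum w f L N (i + 1) z.1)) (μ.prod (volume.restrict (J i))) :=
      (hφ.continuous.comp_aestronglyMeasurable
        (memLp_gridSum hw f L N (i + 1)).1.comp_fst).const_mul _
    refine (h1.sub (hH.mono_measure ?_)).enorm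
    gcongr
    exact hJL i hi
  have hlink : ∀ i < n, ∫⁻ ω, (∫⁻ u in J i, ‖D i ω u‖ₑ) ∂μ ≤
      (ENNReal.ofReal η + ENNReal.ofReal A * ε) * ENNReal.ofReal (L / N) := fun i hi => by
    -- Tonelli: with `u` fixed first, the mean-square estimate for the angle at `u` applies.
    rw [lintegral_lintegral_swap (hDm i hi)]
    have hle : ∀ u ∈ J i, ∫⁻ ω, ‖D i ω u‖ₑ ∂μ ≤ ENNReal.ofReal η + ENNReal.ofReal A * ε :=
      fun u hu => by
      have hu' := hJL i hi hu
      have hdist : |node L N (i + 1) - u| ≤ L / N := by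
        have := node_succ L N i
        rw [abs_le]
        constructor <;> linarith [hu.1, hu.2]
      have hWu := hY.isWienerIntegral u hu'
      refine (lintegral_link_sub_le hφ hφ1 (hA _) (hη _ _ hdist)
        (memLp_gridSum hw f L N (i + 1)).1 hWu.memLp.1).trans ?_
      gcongr
      exact (hWu.eLpNorm_incrementSum_sub_le hw hf.aestronglyMeasurable _
        (fun j _ => toNNReal_node_mono hL.le N j.le_succ) _).trans (hε u hu' _ hdist)
    refine (setLIntegral_mono' measurableSet_Ioc hle).trans_eq ?_
    rw [setLIntegral_const, Real.volume_Ioc, node_succ, add_sub_cancel_left]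
  refine (lintegral_mono_ae hpath).trans ?_
  rw [lintegral_add_right _ measurable_const, lintegral_const, measure_univ, mul_one,
    lintegral_finsetSum' _ fun i hi => (hDm i (Finset.mem_range.1 hi)).lintegral_prod_right']
  gcongr
  refine (Finset.sum_le_sum fun i hi => hlink i (Finset.mem_range.1 hi)).trans ?_
  rw [Finset.sum_const, Finset.card_range, nsmul_eq_mul, mul_comm (_ + _), ← mul_assoc]
  gcongr
  -- The total length of the cells is `n Δ = l_n ≤ L`.
  rw [← ENNReal.ofReal_natCast, ← ENNReal.ofReal_mul (Nat.cast_nonneg n)]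
  exact ENNReal.ofReal_le_ofReal (hnode n hn).2

/-- The Riemann sums converge to the integral in mean. -/
lemma tendsto_lintegral_chainSum_sub [IsProbabilityMeasure μ] (hw : IsPreBrownianReal w μ)
    {φ : ℝ → ℝ} (hφ : LipschitzWith 1 φ) (hφ1 : ∀ x, |φ x| ≤ 1) {a f : ℝ → ℝ} {A M : ℝ}
    (ha : UniformContinuous a) (hA : ∀ x, |a x| ≤ A) (hf : UniformContinuous f)
    (hM : ∀ x, |f x| ≤ M) {L : ℝ} (hL : 0 < L) {Y : ℝ → Ω → ℝ}
    (hY : IsWienerIntegralProcess μ w f L Y) {N n : ℕ → ℕ} (hN : Tendsto N atTop atTop)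
    (hn : ∀ k, n k ≤ N k) {l : ℝ} (hl : l ∈ Set.Icc 0 L)
    (hnl : Tendsto (fun k => node L (N k) (n k)) atTop (𝓝 l)) :
    Tendsto (fun k => ∫⁻ ω, ‖chainSum φ w a f L (N k) (n k) ω -
      ∫ u in (0 : ℝ)..l, a u * φ (Y u ω)‖ₑ ∂μ) atTop (𝓝 0) := by
  refine ENNReal.tendsto_nhds_zero.2 fun ε hε => ?_
  have h2 := ENNReal.half_pos hε.ne'
  have h4 := ENNReal.half_pos h2.ne'
  obtain ⟨η, hη, hηε⟩ := exists_ofReal_mul_le (c := ENNReal.ofReal L) ENNReal.ofReal_ne_top h4.ne'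
  obtain ⟨δ, hδ, hδε⟩ := exists_ofReal_mul_le (c := ENNReal.ofReal L * ENNReal.ofReal A)
    (ENNReal.mul_ne_top ENNReal.ofReal_ne_top ENNReal.ofReal_ne_top) h4.ne'
  have h3 : Tendsto (fun k => ENNReal.ofReal (A * |node L (N k) (n k) - l|)) atTop (𝓝 0) := by
    have := ENNReal.tendsto_ofReal (((hnl.sub_const l).abs).const_mul A)
    simpa using this
  filter_upwards [hN.eventually (eventually_abs_sub_le ha L hη),
    hN.eventually (eventually_eLpNorm_gridFun_sub_le hf hM hL (ENNReal.ofReal_pos.2 hδ).ne'),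
    h3.eventually (ge_mem_nhds h2)] with k hk1 hk2 hk3
  refine (lintegral_chainSum_sub_le hw hφ hφ1 ha.continuous hA hf.continuous hL hY hk1.1 (hn k)
    hk1.2 hk2 hl).trans ?_
  calc _ ≤ (ENNReal.ofReal η * ENNReal.ofReal L +
        ENNReal.ofReal δ * (ENNReal.ofReal L * ENNReal.ofReal A)) + ε / 2 := by
        refine add_le_add (le_of_eq ?_) hk3
        ring
    _ ≤ (ε / 2 / 2 + ε / 2 / 2) + ε / 2 := by gcongr
    _ = ε := by rw [ENNReal.add_halves, ENNReal.add_halves]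

/-- The integrands differ by at most `|α| |X k - X'| + |β| |Y k - Y'|`, because `x ↦ exp (i x)` is
1-Lipschitz on the line. -/
lemma tendsto_pairCharFun [IsFiniteMeasure μ] {X Y : ℕ → Ω → ℝ} {X' Y' : Ω → ℝ}
    (hX : ∀ k, AEStronglyMeasurable (X k) μ) (hY : ∀ k, AEStronglyMeasurable (Y k) μ)
    (hX' : AEStronglyMeasurable X' μ) (hY' : AEStronglyMeasurable Y' μ)
    (hXt : Tendsto (fun k => ∫⁻ ω, ‖X k ω - X' ω‖ₑ ∂μ) atTop (𝓝 0))
    (hYt : Tendsto (fun k => ∫⁻ ω, ‖Y k ω - Y' ω‖ₑ ∂μ) atTop (𝓝 0)) (α β : ℝ) :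
    Tendsto (fun k => pairCharFun μ (X k) (Y k) α β) atTop (𝓝 (pairCharFun μ X' Y' α β)) := by
  have hm : ∀ {U V : Ω → ℝ}, AEStronglyMeasurable U μ → AEStronglyMeasurable V μ →
      AEStronglyMeasurable
        (fun ω => Complex.exp (Complex.I * ((α * U ω + β * V ω : ℝ) : ℂ))) μ := fun hU hV =>
    (show Continuous fun x : ℝ => Complex.exp (Complex.I * (x : ℂ)) by fun_prop
      ).comp_aestronglyMeasurable ((hU.const_mul α).add (hV.const_mul β))
  have hexp : ∀ x y : ℝ, ‖Complex.exp (Complex.I * x) - Complex.exp (Complex.I * y)‖ ≤ |x - y| := by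
    intro x y
    have e : Complex.exp (Complex.I * x) - Complex.exp (Complex.I * y) =
        Complex.exp (Complex.I * y) * (Complex.exp (Complex.I * ((x - y : ℝ) : ℂ)) - 1) := by
      rw [mul_sub, ← Complex.exp_add, mul_one, Complex.ofReal_sub, ← mul_add]
      congr 3
      ring
    rw [e, norm_mul, mul_comm Complex.I (y : ℂ), Complex.norm_exp_ofReal_mul_I, one_mul]
    exact Real.norm_exp_I_mul_ofReal_sub_one_le
  refine tendsto_integral_of_L1 _ (hm hX' hY') (Eventually.of_forall fun k => ?_) ?_
  · refine Integrable.of_bound (hm (hX k) (hY k)) 1 (ae_of_all _ fun ω => ?_)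
    rw [mul_comm Complex.I, Complex.norm_exp_ofReal_mul_I]
  have hlim : Tendsto (fun k => ‖α‖ₑ * ∫⁻ ω, ‖X k ω - X' ω‖ₑ ∂μ +
      ‖β‖ₑ * ∫⁻ ω, ‖Y k ω - Y' ω‖ₑ ∂μ) atTop (𝓝 0) := by
    simpa using (ENNReal.Tendsto.const_mul hXt (Or.inr enorm_ne_top)).add
      (ENNReal.Tendsto.const_mul hYt (Or.inr enorm_ne_top))
  refine tendsto_of_tendsto_of_tendsto_of_le_of_le tendsto_const_nhds hlim (fun _ => zero_le)
    fun k => ?_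
  have hXm := ((hX k).sub hX').enorm
  have hYm := ((hY k).sub hY').enorm
  simp only [Pi.sub_apply] at hXm hYm
  rw [← lintegral_const_mul'' _ hXm, ← lintegral_const_mul'' _ hYm,
    ← lintegral_add_left' (hXm.const_mul _)]
  refine lintegral_mono fun ω => ?_
  calc _ ≤ ‖(α * X k ω + β * Y k ω) - (α * X' ω + β * Y' ω)‖ₑ :=
        enorm_le_iff_norm_le.2 (hexp _ _)
    _ = ‖α * (X k ω - X' ω) + β * (Y k ω - Y' ω)‖ₑ := by ring_nf
    _ ≤ _ := by
      rw [← enorm_mul, ← enorm_mul]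
      exact enorm_add_le _ _

end convergence

/-! ### Reduction to globally defined coefficients -/

/-- Continue `g` by its end values. The estimates can then use a bound and a modulus of continuity
on the whole line. -/
lemma ContinuousOn.exists_uniformContinuous_extension {g : ℝ → ℝ} {L : ℝ} (hL : 0 ≤ L)
    (hg : ContinuousOn g (Set.Icc 0 L)) :
    ∃ g' : ℝ → ℝ, UniformContinuous g' ∧ (∃ M, ∀ x, |g' x| ≤ M) ∧
      Set.EqOn g g' (Set.Icc 0 L) := by
  refine ⟨Set.IccExtend hL ((Set.Icc 0 L).domRestrict g), ?_, ?_, fun x hx => ?_⟩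
  · exact (CompactSpace.uniformContinuous_of_continuous hg.domRestrict).comp
      (LipschitzWith.projIcc hL).uniformContinuous
  · obtain ⟨M, hM⟩ := isCompact_Icc.exists_bound_of_continuousOn hg
    exact ⟨M, fun x => hM _ (Set.projIcc 0 L hL x).2⟩
  · rw [Set.IccExtend_of_mem hL _ hx]
    rfl

/-- Projecting both variables onto the rectangle gives an integrand continuous on the plane, without
changing the integral over `[0, t]` for `θ ∈ [0, L]`. -/
lemma continuousOn_angleIntensity {σ : ℝ → ℝ → ℝ} {L T t : ℝ} (hL : 0 ≤ L)
    (hσ : ContinuousOn (Function.uncurry σ) (Set.Icc 0 L ×ˢ Set.Icc 0 T))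
    (ht : t ∈ Set.Icc 0 T) : ContinuousOn (angleIntensity σ t) (Set.Icc 0 L) := by
  have hT : 0 ≤ T := ht.1.trans ht.2
  set σ' : ℝ → ℝ → ℝ := fun θ τ => σ (Set.projIcc 0 L hL θ) (Set.projIcc 0 T hT τ) with hσ'
  have hc : Continuous (Function.uncurry σ') :=
    hσ.comp_continuous (f := fun z : ℝ × ℝ =>
        ((Set.projIcc 0 L hL z.1 : ℝ), (Set.projIcc 0 T hT z.2 : ℝ)))
      ((continuous_subtype_val.comp (continuous_projIcc.comp continuous_fst)).prodMk
        (continuous_subtype_val.comp (continuous_projIcc.comp continuous_snd)))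
      fun z => ⟨(Set.projIcc 0 L hL z.1).2, (Set.projIcc 0 T hT z.2).2⟩
  have hI : Continuous fun θ => ∫ τ in (0 : ℝ)..t, σ' θ τ ^ 2 :=
    intervalIntegral.continuous_parametric_intervalIntegral_of_continuous'
      (f := fun θ τ => σ' θ τ ^ 2) (show Continuous fun z => Function.uncurry σ' z ^ 2 from
        hc.pow 2) 0 t
  refine (Real.continuous_sqrt.comp (hI.const_mul (1 / 2))).continuousOn.congr fun θ hθ => ?_
  simp only [angleIntensity, Function.comp]
  congr 2
  refine intervalIntegral.integral_congr fun τ hτ => ?_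
  rw [Set.uIcc_of_le ht.1] at hτ
  simp only [hσ']
  rw [Set.projIcc_of_mem hL hθ, Set.projIcc_of_mem hT ⟨hτ.1, hτ.2.trans ht.2⟩]

/-- The approximation of the integrand is tested only on `(0, u] ⊆ [0, L]`. -/
lemma IsWienerIntegralProcess.congr {Ω : Type*} [MeasurableSpace Ω] {μ : Measure Ω}
    {w : ℝ≥0 → Ω → ℝ} {f g : ℝ → ℝ} {L : ℝ} {Y : ℝ → Ω → ℝ}
    (hY : IsWienerIntegralProcess μ w f L Y) (hfg : Set.EqOn f g (Set.Icc 0 L)) :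
    IsWienerIntegralProcess μ w g L Y := by
  refine ⟨hY.aestronglyMeasurable, fun u hu => ?_⟩
  obtain ⟨h0, m, τ, c, h1, h2, h3⟩ := hY.isWienerIntegral u hu
  refine ⟨h0, m, τ, c, h1, h2.congr fun k => eLpNorm_congr_ae ?_, h3⟩
  refine ae_restrict_of_forall_mem measurableSet_Ioc fun θ hθ => ?_
  simp only [hfg ⟨hθ.1.le, hθ.2.trans hu.2⟩]

lemma sum_link_eq_chainSum {Ω : Type*} (φ : ℝ → ℝ) (w : ℝ≥0 → Ω → ℝ) {a a' f : ℝ → ℝ}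
    {σ : ℝ → ℝ → ℝ} {t L : ℝ} (hL : 0 ≤ L) (ha : Set.EqOn a a' (Set.Icc 0 L))
    (hf : Set.EqOn (angleIntensity σ t) f (Set.Icc 0 L)) {N n : ℕ} (hN : N ≠ 0) (hn : n ≤ N) :
    (fun ω => ∑ s ∈ Finset.Icc 1 n, a (node L N s) * φ (chainAngle w σ t L N s ω) * (L / N)) =
      chainSum φ w a' f L N n := by
  ext ω
  refine Finset.sum_congr rfl fun s hs => ?_
  have hs := (Finset.mem_Icc.1 hs).2
  have e : chainAngle w σ t L N s ω = gridSum w f L N s ω := by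
    refine Finset.sum_congr rfl fun j hj => ?_
    have hj := (Finset.mem_Icc.1 hj).2
    rw [hf (node_mem_Icc hL hN (hj.trans (hs.trans hn))), mul_comm]
  rw [e, ha (node_mem_Icc hL hN (hs.trans hn))]

theorem theorem1 {Ω : Type*} [MeasurableSpace Ω] (μ : Measure Ω) [IsProbabilityMeasure μ]
    (w : ℝ≥0 → Ω → ℝ) (hw : IsBrownianReal w μ)
    (L T : ℝ) (hL : 0 < L)
    (a : ℝ → ℝ) (ha : ContDiffOn ℝ 1 a (Set.Icc 0 L)) (ha_pos : ∀ l ∈ Set.Icc 0 L, 0 < a l)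
    (σ : ℝ → ℝ → ℝ)
    (hσ : ContDiffOn ℝ 2 (Function.uncurry σ) (Set.Icc 0 L ×ˢ Set.Icc 0 T))
    (t : ℝ) (ht : t ∈ Set.Icc 0 T) :
    (∃ Y : ℝ → Ω → ℝ, IsWienerIntegralProcess μ w (angleIntensity σ t) L Y) ∧
    ∀ Y : ℝ → Ω → ℝ, IsWienerIntegralProcess μ w (angleIntensity σ t) L Y →
      ∀ l ∈ Set.Icc 0 L, ∀ N n : ℕ → ℕ, Tendsto N atTop atTop → (∀ k, n k ≤ N k) →
        Tendsto (fun k => node L (N k) (n k)) atTop (𝓝 l) →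
        ∀ α β : ℝ,
          Tendsto (fun k => pairCharFun μ (chainX w a σ t L (N k) (n k))
              (chainY w a σ t L (N k) (n k)) α β) atTop
            (𝓝 (pairCharFun μ (contX a Y l) (contY a Y l) α β)) := by
  have hpre := hw.toIsPreBrownianReal
  obtain ⟨f, hf, ⟨M, hM⟩, hff⟩ :=
    (continuousOn_angleIntensity hL.le hσ.continuousOn ht).exists_uniformContinuous_extension hL.le
  obtain ⟨b, hb, ⟨A, hA⟩, hab⟩ := ha.continuousOn.exists_uniformContinuous_extension hL.le
  refine ⟨?_, fun Y hYσ l hl N n hN hn hnl α β => ?_⟩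
  · obtain ⟨Y, hY⟩ := exists_isWienerIntegralProcess hpre hf hM hL
    exact ⟨Y, hY.congr hff.symm⟩
  have hY := hYσ.congr hff
  have hcont : ∀ φ : ℝ → ℝ, (fun ω => ∫ u in (0 : ℝ)..l, a u * φ (Y u ω)) =
      fun ω => ∫ u in (0 : ℝ)..l, b u * φ (Y u ω) := fun φ => by
    ext ω
    refine intervalIntegral.integral_congr fun u hu => ?_
    rw [Set.uIcc_of_le hl.1] at hu
    simp only [hab ⟨hu.1, hu.2.trans hl.2⟩]
  have hX : contX a Y l = fun ω => ∫ u in (0 : ℝ)..l, b u * Real.cos (Y u ω) := hcont Real.cos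
  have hX' : contY a Y l = fun ω => ∫ u in (0 : ℝ)..l, b u * Real.sin (Y u ω) := hcont Real.sin
  rw [hX, hX']
  have hchain : ∀ φ : ℝ → ℝ, Continuous φ → ∀ k,
      AEStronglyMeasurable (chainSum φ w b f L (N k) (n k)) μ := fun φ hφ k => by
    refine Finset.aestronglyMeasurable_fun_sum _ fun s _ => ?_
    exact ((hφ.comp_aestronglyMeasurable (memLp_gridSum hpre f L (N k) s).1).const_mul _).mul_const _
  have hmeas : ∀ φ : ℝ → ℝ, Continuous φ →
      AEStronglyMeasurable (fun ω => ∫ u in (0 : ℝ)..l, b u * φ (Y u ω)) μ := fun φ hφ =>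
    aestronglyMeasurable_intervalIntegral (hY.aestronglyMeasurable_mul_comp hφ hb.continuous) hl
  refine (tendsto_pairCharFun (hchain _ Real.continuous_cos) (hchain _ Real.continuous_sin)
    (hmeas _ Real.continuous_cos) (hmeas _ Real.continuous_sin)
    (tendsto_lintegral_chainSum_sub hpre Real.lipschitzWith_cos Real.abs_cos_le_one hb hA hf hM hL
      hY hN hn hl hnl)
    (tendsto_lintegral_chainSum_sub hpre Real.lipschitzWith_sin Real.abs_sin_le_one hb hA hf hM hL
      hY hN hn hl hnl) α β).congr' ?_
  filter_upwards [hN.eventually (eventually_ne_atTop 0)] with k hk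
  rw [← sum_link_eq_chainSum Real.cos w hL.le hab hff hk (hn k),
    ← sum_link_eq_chainSum Real.sin w hL.le hab hff hk (hn k)]
  rfl
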